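/- Let $n\ge 0$ and let $M_0 \xleftarrow{p_0} M_1 \xleftarrow{p_1} M_2 \leftarrow\cdots$ be a sequence of closed connected topological $n$-manifolds (compact, connected, Hausdorff, locally homeomorphic to $\mathbb R^n$) and covering maps $p_i\colon M_{i+1}\to M_i$ such that every finite composition $p_i\circ p_{i+1}\circ\cdots\circ p_{i+k}\colon M_{i+k+1}\to M_i$ is a regular covering map (that is, its deck transformations act transitively on each fibre). Let $$M_\infty=\varprojlim (M_i,p_i)=\Bigl\{(x_i)\in\prod_i M_i : p_i(x_{i+1})=x_i \text{ for all } i\Bigr\}$$ be the associated solenoid, with the subspace topology of the product, let $\pi_0\colon M_\infty\to M_0$ be the projection to the first coordinate, and let $\Gamma_0$ be the structure group of the principal bundle $\pi_0$, that is, the group of its deck transformations (the homeomorphisms $h\colon M_\infty\to M_\infty$ with $\pi_0\circ h=\pi_0$) with the compact-open topology. If $M_\infty$ is bihomogeneous, i.e. for all $x,y\in M_\infty$ there is a homeomorphism $h\colon M_\infty\to M_\infty$ with $h(x)=y$ and $h(y)=x$, then $\Gamma_0$ contains an open abelian subgroup. -/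

import Mathlib

/-- A space is bihomogeneous if any two points are interchanged by a self-homeomorphism. -/
def IsBihomogeneous (X : Type*) [TopologicalSpace X] : Prop :=
  ∀ x y : X, ∃ h : X ≃ₜ X, h x = y ∧ h y = x

/-- The group of deck transformations of a map `f : E → B`: the self-homeomorphisms of `E`
that preserve every fibre of `f`, under composition. -/
def deckGroup {E B : Type*} [TopologicalSpace E] (f : E → B) : Subgroup (E ≃ₜ E) where
  carrier := {h | ∀ x, f (h x) = f x}
  one_mem' := fun _ => rfl
  mul_mem' := fun {a b} ha hb x => (ha (b x)).trans (hb x)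
  inv_mem' := fun {a} ha x => by
    have h := ha (a⁻¹ x)
    rw [← h]
    exact congrArg f (a.apply_symm_apply x)

/-- The deck transformations carry the compact-open topology. -/
instance deckGroup.instTopologicalSpace {E B : Type*} [TopologicalSpace E] (f : E → B) :
    TopologicalSpace (deckGroup f) :=
  TopologicalSpace.induced (fun h => ((h : E ≃ₜ E) : C(E, E))) inferInstance

/-- A covering map is regular (normal, Galois) if its deck transformations act transitively on
every fibre. -/
structure IsRegularCoveringMap {E B : Type*} [TopologicalSpace E] [TopologicalSpace B]
    (f : E → B) : Prop where
  isCoveringMap : IsCoveringMap f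
  transitive : ∀ x y : E, f x = f y → ∃ h ∈ deckGroup f, h x = y

section Solenoid

variable {M : ℕ → Type*} (p : ∀ i, M (i + 1) → M i)

/-- The composition `p i ∘ p (i + 1) ∘ ⋯ ∘ p (i + k - 1) : M (i + k) → M i` of `k` consecutive
bonding maps. -/
def bondingComp (i : ℕ) : ∀ k, M (i + k) → M i
  | 0 => id
  | k + 1 => bondingComp i k ∘ p (i + k)

/-- The inverse limit of the sequence `M 0 ← M 1 ← M 2 ← ⋯`, as a subspace of the product. -/
abbrev InverseLimit : Type _ :=
  {x : ∀ i, M i // ∀ i, p i (x (i + 1)) = x i}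

/-- The projection of the inverse limit onto the first factor space `M 0`. -/
def InverseLimit.proj₀ (x : InverseLimit p) : M 0 := x.1 0

/-- The bonding maps of a solenoid are covering maps all of whose finite compositions are
regular covering maps. -/
structure IsSolenoidSequence [∀ i, TopologicalSpace (M i)] : Prop where
  covering : ∀ i, IsCoveringMap (p i)
  regular : ∀ i k, IsRegularCoveringMap (bondingComp p i k)

/-- The structure group of the principal bundle `M_∞ → M 0`, as its group of deck
transformations. -/
abbrev structureGroup [∀ i, TopologicalSpace (M i)] : Type _ :=
  deckGroup (InverseLimit.proj₀ p)

end Solenoid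

/-! A group on which inversion is a homomorphism is abelian; bihomogeneity yields a homeomorphism
that inverts the structure group near the identity. Call points of `M_∞` close when at every level a
connected set over a small subset of `M 0` joins them. If the projections of `f` and `g` to `M 0`
are uniformly close, closeness of `f x` and `g x` at one `x` spreads over the connected solenoid.

Fix `x₀`. For `y` in its fibre let `h y` swap `x₀` and `y`, and let the deck transformation `s y`
carry `x₀` to `y`. Second countability of the mapping space sorts the `h y` into countably many
classes with close projections; by Baire one class is dense near a member `y₀`. For `y` in it, `h
y₀` and `s y₀ (s y)⁻¹ h y` agree at `x₀`, so are close at `y`: with `τ = s y (s y₀)⁻¹`, `h y₀ (τ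
y₀)` is close to `τ⁻¹ x₀`. Density extends this to all `τ` trivial at a high level
(`exists_homeomorph_inverting`).

Write `h` for `h y₀`. For such `a`, `b`, `h ∘ a` and `a⁻¹ ∘ h` are close at `y₀`, hence everywhere,
so `h (a b y₀)` is close to both `a⁻¹ b⁻¹ x₀` and `b⁻¹ a⁻¹ x₀`. A plaque meets a fibre once, so
these coincide, and deck transformations agreeing at a point are equal
(`exists_levelSubgroup_commute`). -/

open Set Filter Topology

/-! ### Sheets of a covering map -/

/-- Two points of `E` are in the same sheet of `q` over `C` if some preconnected subset of
`q ⁻¹' C` contains both. -/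
def SameSheet {E B : Type*} [TopologicalSpace E] (q : E → B) (C : Set B) (a b : E) : Prop :=
  ∃ T : Set E, IsPreconnected T ∧ T ⊆ q ⁻¹' C ∧ a ∈ T ∧ b ∈ T

namespace SameSheet

variable {E B : Type*} [TopologicalSpace E] {q : E → B} {C : Set B} {a b c : E}

theorem symm (h : SameSheet q C a b) : SameSheet q C b a :=
  let ⟨T, hT, hTC, ha, hb⟩ := h
  ⟨T, hT, hTC, hb, ha⟩

theorem trans (h : SameSheet q C a b) (h' : SameSheet q C b c) : SameSheet q C a c := by
  obtain ⟨T, hT, hTC, ha, hb⟩ := h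
  obtain ⟨T', hT', hTC', hb', hc⟩ := h'
  exact ⟨T ∪ T', hT.union b hb hb' hT', union_subset hTC hTC', .inl ha, .inr hc⟩

theorem mono {D : Set B} (hCD : C ⊆ D) (h : SameSheet q C a b) : SameSheet q D a b :=
  let ⟨T, hT, hTC, ha, hb⟩ := h
  ⟨T, hT, hTC.trans (preimage_mono hCD), ha, hb⟩

theorem left_mem (h : SameSheet q C a b) : q a ∈ C :=
  let ⟨_, _, hTC, ha, _⟩ := h
  hTC ha

theorem right_mem (h : SameSheet q C a b) : q b ∈ C := h.symm.left_mem

theorem map_deck {d : E ≃ₜ E} (hd : d ∈ deckGroup q) (h : SameSheet q C a b) :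
    SameSheet q C (d a) (d b) := by
  obtain ⟨T, hT, hTC, ha, hb⟩ := h
  refine ⟨d '' T, hT.image d d.continuous.continuousOn, ?_, mem_image_of_mem d ha,
    mem_image_of_mem d hb⟩
  rintro _ ⟨x, hx, rfl⟩
  rw [mem_preimage, hd x]
  exact hTC hx

theorem eventually [LocallyConnectedSpace E] [TopologicalSpace B] (hq : Continuous q)
    (hC : IsOpen C) (ha : q a ∈ C) : ∀ᶠ b in 𝓝 a, SameSheet q C a b := by
  obtain ⟨T, hTC, hTo, haT, hT⟩ := locallyConnectedSpace_iff_subsets_isOpen_isConnected.1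
    inferInstance a (q ⁻¹' C) ((hC.preimage hq).mem_nhds ha)
  filter_upwards [hTo.mem_nhds haT] with b hb using ⟨T, hT.isPreconnected, hTC, haT, hb⟩

end SameSheet

section Lifting

variable {E B : Type*} [TopologicalSpace E] [TopologicalSpace B] {q : E → B} {U C : Set B} {a b : E}

theorem IsCoveringMap.exists_section (hq : IsCoveringMap q) [SimplyConnectedSpace U]
    [LocallyPathConnectedSpace U] (ha : q a ∈ U) :
    ∃ s : C(U, E), s ⟨q a, ha⟩ = a ∧ ∀ u, q (s u) = u := by
  obtain ⟨s, ⟨hs, hqs⟩, -⟩ := hq.existsUnique_continuousMap_lifts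
    (⟨Subtype.val, continuous_subtype_val⟩ : C(U, B)) ⟨q a, ha⟩ a rfl
  exact ⟨s, hs, fun u => congrFun hqs u⟩

/-- On the preconnected set `T` the identity and `s ∘ q` are lifts of `q` agreeing at `a`, hence
also at `b`. -/
theorem SameSheet.eq_of_apply_eq (hq : IsCoveringMap q) [SimplyConnectedSpace U]
    [LocallyPathConnectedSpace U] (h : SameSheet q U a b) (hab : q a = q b) : a = b := by
  obtain ⟨T, hT, hTU, ha, hb⟩ := h
  obtain ⟨s, hsa, hs⟩ := hq.exists_section (U := U) (hTU ha)
  classical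
  let g : E → E := fun x => if hx : q x ∈ U then s ⟨q x, hx⟩ else x
  have hg : ∀ x (hx : q x ∈ U), g x = s ⟨q x, hx⟩ := fun x hx => dif_pos hx
  have hgc : ContinuousOn g T := by
    rw [continuousOn_iff_continuous_domRestrict]
    have : T.domRestrict g = fun x : T => s ⟨q x, hTU x.2⟩ := by
      ext x; exact hg x (hTU x.2)
    rw [this]
    exact s.continuous.comp ((hq.continuous.comp continuous_subtype_val).subtype_mk _)
  have key := hq.eqOn_of_comp_eqOn hT continuousOn_id hgc
    (fun x hx => by simp [hg x (hTU hx), hs]) ha (by simp [hg a (hTU ha), hsa])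
  have hb' : b = g b := key hb
  rw [hb', hg b (hTU hb)]
  have : (⟨q b, hTU hb⟩ : U) = ⟨q a, hTU ha⟩ := Subtype.ext hab.symm
  rw [this, hsa]

theorem SameSheet.exists_apply_eq (hq : IsCoveringMap q) [SimplyConnectedSpace U]
    [LocallyPathConnectedSpace U] (hC : IsPreconnected C) (hCU : C ⊆ U) (ha : q a ∈ C) {c : B}
    (hc : c ∈ C) : ∃ b, q b = c ∧ SameSheet q C a b := by
  obtain ⟨s, hsa, hs⟩ := hq.exists_section (hCU ha)
  have hC' : IsPreconnected (Subtype.val ⁻¹' C : Set U) := by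
    rw [← Topology.IsInducing.subtypeVal.isPreconnected_image,
      image_preimage_eq_of_subset (by simpa)]
    exact hC
  refine ⟨s ⟨c, hCU hc⟩, hs _, s '' (Subtype.val ⁻¹' C), hC'.image s s.continuous.continuousOn, ?_,
    ⟨⟨q a, hCU ha⟩, ha, hsa⟩, ⟨⟨c, hCU hc⟩, hc, rfl⟩⟩
  rintro _ ⟨u, hu, rfl⟩
  rwa [mem_preimage, hs u]

end Lifting

/-! ### Plaque covers -/

/-- A cover of a space by connected open sets such that the union of all members through a given
point lies in a simply connected, locally path-connected set. -/
structure IsPlaqueCover {B : Type*} [TopologicalSpace B] (𝒞 : Set (Set B)) : Prop where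
  isOpen : ∀ C ∈ 𝒞, IsOpen C
  isPreconnected : ∀ C ∈ 𝒞, IsPreconnected C
  exists_mem : ∀ b, ∃ C ∈ 𝒞, b ∈ C
  star : ∀ b, ∃ U : Set B, SimplyConnectedSpace U ∧ LocallyPathConnectedSpace U ∧
    ∀ C ∈ 𝒞, b ∈ C → C ⊆ U

/-- Two points of `E` are in the same plaque if they are in the same sheet over some member
of `𝒞`. -/
def SamePlaque {E B : Type*} [TopologicalSpace E] (q : E → B) (𝒞 : Set (Set B)) (a b : E) : Prop :=
  ∃ C ∈ 𝒞, SameSheet q C a b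

namespace IsPlaqueCover

variable {E B : Type*} [TopologicalSpace E] [TopologicalSpace B] {q : E → B} {𝒞 : Set (Set B)}
  {C : Set B} {a b : E}

theorem eq_of_sameSheet (h𝒞 : IsPlaqueCover 𝒞) (hq : IsCoveringMap q) (hC : C ∈ 𝒞)
    (h : SameSheet q C a b) (hab : q a = q b) : a = b := by
  obtain ⟨U, _, _, hU⟩ := h𝒞.star (q a)
  exact (h.mono (hU C hC h.left_mem)).eq_of_apply_eq hq hab

/-- The star condition serves here: `C` and `D` both contain `q a`, so they lie in a common simply
connected `U`, over which a sheet meets each fibre at most once. -/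
theorem sameSheet_of_samePlaque (h𝒞 : IsPlaqueCover 𝒞) (hq : IsCoveringMap q) (hC : C ∈ 𝒞)
    (ha : q a ∈ C) (hb : q b ∈ C) (h : SamePlaque q 𝒞 a b) : SameSheet q C a b := by
  obtain ⟨D, hD, h⟩ := h
  obtain ⟨U, _, _, hU⟩ := h𝒞.star (q a)
  obtain ⟨b', hb', h'⟩ :=
    SameSheet.exists_apply_eq hq (h𝒞.isPreconnected C hC) (hU C hC ha) ha hb
  have : b' = b := ((h'.mono (hU C hC ha)).symm.trans
    (h.mono (hU D hD h.left_mem))).eq_of_apply_eq hq hb'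
  exact this ▸ h'

theorem samePlaque_iff_sameSheet (h𝒞 : IsPlaqueCover 𝒞) (hq : IsCoveringMap q) (hC : C ∈ 𝒞)
    (ha : q a ∈ C) (hb : q b ∈ C) : SamePlaque q 𝒞 a b ↔ SameSheet q C a b :=
  ⟨h𝒞.sameSheet_of_samePlaque hq hC ha hb, fun h => ⟨C, hC, h⟩⟩

/-- Being in the same plaque is a locally constant property of pairs of points whose projections
lie in a common member of the cover. -/
theorem eventually_samePlaque_iff [LocallyConnectedSpace E] (h𝒞 : IsPlaqueCover 𝒞)
    (hq : IsCoveringMap q) (hC : C ∈ 𝒞) (ha : q a ∈ C) (hb : q b ∈ C) :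
    ∀ᶠ z in 𝓝 (a, b), SamePlaque q 𝒞 z.1 z.2 ↔ SamePlaque q 𝒞 a b := by
  filter_upwards [prod_mem_nhds (SameSheet.eventually hq.continuous (h𝒞.isOpen C hC) ha)
    (SameSheet.eventually hq.continuous (h𝒞.isOpen C hC) hb)] with z hz
  obtain ⟨h₁ : SameSheet q C a z.1, h₂ : SameSheet q C b z.2⟩ := hz
  rw [h𝒞.samePlaque_iff_sameSheet hq hC h₁.right_mem h₂.right_mem,
    h𝒞.samePlaque_iff_sameSheet hq hC ha hb]
  exact ⟨fun h => h₁.trans (h.trans h₂.symm), fun h => h₁.symm.trans (h.trans h₂)⟩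

theorem samePlaque_of_preconnected {X : Type*} [TopologicalSpace X] [PreconnectedSpace X]
    [LocallyConnectedSpace E] (h𝒞 : IsPlaqueCover 𝒞) (hq : IsCoveringMap q) {f g : X → E}
    (hf : Continuous f) (hg : Continuous g) (hfg : ∀ x, ∃ C ∈ 𝒞, q (f x) ∈ C ∧ q (g x) ∈ C)
    {x₀ : X} (h₀ : SamePlaque q 𝒞 (f x₀) (g x₀)) (x : X) : SamePlaque q 𝒞 (f x) (g x) := by
  have key : ∀ x, ∀ᶠ y in 𝓝 x, SamePlaque q 𝒞 (f y) (g y) ↔ SamePlaque q 𝒞 (f x) (g x) := by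
    intro x
    obtain ⟨C, hC, h₁, h₂⟩ := hfg x
    exact (hf.prodMk hg).continuousAt.eventually (h𝒞.eventually_samePlaque_iff hq hC h₁ h₂)
  have hclopen : IsClopen {x | SamePlaque q 𝒞 (f x) (g x)} := by
    refine ⟨⟨isOpen_iff_mem_nhds.2 fun x hx => ?_⟩, isOpen_iff_mem_nhds.2 fun x hx => ?_⟩
    · filter_upwards [key x] with y hy using fun h => hx (hy.1 h)
    · filter_upwards [key x] with y hy using hy.2 hx
  have := hclopen.eq_univ ⟨x₀, h₀⟩
  exact (this ▸ mem_univ x : x ∈ {x | SamePlaque q 𝒞 (f x) (g x)})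

end IsPlaqueCover

theorem exists_isOpen_simplyConnected_of_chartedSpace (n : ℕ) {B : Type*} [TopologicalSpace B]
    [ChartedSpace (EuclideanSpace ℝ (Fin n)) B] (b : B) :
    ∃ U : Set B, IsOpen U ∧ b ∈ U ∧ SimplyConnectedSpace U ∧ LocallyPathConnectedSpace U := by
  have := ChartedSpace.locallyPathConnectedSpace (EuclideanSpace ℝ (Fin n)) B
  let e := chartAt (EuclideanSpace ℝ (Fin n)) b
  obtain ⟨r, hr, hball⟩ := Metric.isOpen_iff.1 e.open_target (e b)
    (e.map_source (mem_chart_source _ b))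
  let e' := e.symm.restr (Metric.ball (e b) r)
  have he' : e'.source = Metric.ball (e b) r := by
    simp only [e', OpenPartialHomeomorph.restr_source, OpenPartialHomeomorph.symm_source,
      Metric.isOpen_ball.interior_eq]
    exact inter_eq_right.2 hball
  have hc : ContractibleSpace e'.source := by
    rw [he']
    exact (convex_ball _ _).contractibleSpace ⟨e b, Metric.mem_ball_self hr⟩
  have : ContractibleSpace e'.target :=
    e'.toHomeomorphSourceTarget.symm.contractibleSpace
  refine ⟨e'.target, e'.open_target, ?_, inferInstance, e'.open_target.locallyPathConnectedSpace⟩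
  have := e'.map_source (x := e b) (he' ▸ Metric.mem_ball_self hr)
  rwa [show e' (e b) = b from e.left_inv (mem_chart_source _ b)] at this

theorem exists_isPlaqueCover (n : ℕ) (B : Type*) [TopologicalSpace B]
    [ChartedSpace (EuclideanSpace ℝ (Fin n)) B] [T2Space B] [CompactSpace B] :
    ∃ 𝒞 : Set (Set B), IsPlaqueCover 𝒞 := by
  have := ChartedSpace.locallyConnectedSpace (EuclideanSpace ℝ (Fin n)) B
  have := ChartedSpace.secondCountable_of_sigmaCompact (EuclideanSpace ℝ (Fin n)) B
  let _ := TopologicalSpace.metrizableSpaceMetric B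
  choose U hUo hU hUs hUl using exists_isOpen_simplyConnected_of_chartedSpace n (B := B)
  obtain ⟨δ, hδ, hball⟩ := lebesgue_number_lemma_of_metric isCompact_univ hUo
    (fun b _ => mem_iUnion.2 ⟨b, hU b⟩)
  -- With `δ` a Lebesgue number of the cover by the `U b`, all members through `b` lie in the
  -- `δ`-ball about `b`, hence in one `U i`.
  refine ⟨{C | IsOpen C ∧ IsPreconnected C ∧ ∀ b ∈ C, C ⊆ Metric.ball b δ},
    fun C hC => hC.1, fun C hC => hC.2.1, fun b => ?_, fun b => ?_⟩
  · obtain ⟨C, hCb, hCo, hbC, hC⟩ := locallyConnectedSpace_iff_subsets_isOpen_isConnected.1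
      inferInstance b _ (Metric.ball_mem_nhds b (half_pos hδ))
    refine ⟨C, ⟨hCo, hC.isPreconnected, fun c hc x hx => ?_⟩, hbC⟩
    have h₁ := Metric.mem_ball.1 (hCb hc)
    have h₂ := Metric.mem_ball.1 (hCb hx)
    rw [Metric.mem_ball]
    linarith [dist_triangle_right x c b]
  · obtain ⟨i, hi⟩ := hball b (mem_univ b)
    exact ⟨U i, hUs i, hUl i, fun C hC hb => (hC.2.2 b hb).trans hi⟩

theorem IsCoveringMap.surjective_of_compact {E B : Type*} [TopologicalSpace E] [TopologicalSpace B]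
    [CompactSpace E] [Nonempty E] [T2Space B] [PreconnectedSpace B] {q : E → B}
    (hq : IsCoveringMap q) : Function.Surjective q := by
  have h : IsClopen (range q) :=
    ⟨(isCompact_range hq.continuous).isClosed, hq.isOpenMap.isOpen_range⟩
  exact range_eq_univ.1 (h.eq_univ (range_nonempty q))

/-! ### Inverse limits of compact spaces -/

section Bonding

variable {M : ℕ → Type*} (p : ∀ i, M (i + 1) → M i)

/-- The composition `p 0 ∘ p 1 ∘ ⋯ ∘ p (k - 1) : M k → M 0` of bonding maps. -/
def bondingToBase : ∀ k, M k → M 0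
  | 0 => id
  | k + 1 => bondingToBase k ∘ p k

/-- The cast is needed because `0 + k` does not reduce to `k`. -/
theorem bondingToBase_eq_bondingComp (k : ℕ) :
    ∀ (h : k = 0 + k) (x : M k), bondingToBase p k x = bondingComp p 0 k (cast (congrArg M h) x) := by
  have hcast : ∀ (i j : ℕ) (h : i = j) (x : M (i + 1)),
      cast (congrArg M h) (p i x) = p j (cast (congrArg M (congrArg (· + 1) h)) x) := by
    rintro i _ rfl x
    rfl
  induction k with
  | zero => exact fun _ _ => rfl
  | succ k ih =>
    intro h x
    have hk : k = 0 + k := (Nat.zero_add k).symm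
    change bondingToBase p k (p k x) = bondingComp p 0 k (p (0 + k) _)
    rw [ih hk, hcast k (0 + k) hk]

theorem IsSolenoidSequence.isRegularCoveringMap_bondingToBase [∀ i, TopologicalSpace (M i)]
    {p : ∀ i, M (i + 1) → M i} (hp : IsSolenoidSequence p) (k : ℕ) :
    IsRegularCoveringMap (bondingToBase p k) := by
  have key : ∀ (j : ℕ) (h : j = 0 + k),
      IsRegularCoveringMap fun x : M j => bondingComp p 0 k (cast (congrArg M h) x) := by
    rintro _ rfl
    exact hp.regular 0 k
  have hk : k = 0 + k := (Nat.zero_add k).symm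
  have := key k hk
  rwa [← funext (bondingToBase_eq_bondingComp p k hk)] at this

namespace InverseLimit

variable {p}

theorem bondingToBase_apply (x : InverseLimit p) (k : ℕ) : bondingToBase p k (x.1 k) = x.1 0 := by
  induction k with
  | zero => rfl
  | succ k ih => rw [← ih, ← x.2 k]; rfl

theorem eq_of_apply_eq_of_le {x y : InverseLimit p} {i j : ℕ} (hij : i ≤ j)
    (h : x.1 j = y.1 j) : x.1 i = y.1 i := by
  induction j, hij using Nat.le_induction with
  | base => exact h
  | succ j _ ih => exact ih (by rw [← x.2 j, ← y.2 j, h])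

theorem surjective_apply {M : ℕ → Type*} {p : ∀ i, M (i + 1) → M i}
    (hp : ∀ i, Function.Surjective (p i)) (k : ℕ) :
    Function.Surjective fun x : InverseLimit p => x.1 k := by
  induction k generalizing M with
  | zero =>
    intro m
    choose s hs using hp
    exact ⟨⟨fun i => Nat.rec m (fun i y => s i y) i, fun i => hs i _⟩, rfl⟩
  | succ k ih =>
    intro m
    obtain ⟨x, hx⟩ := ih (M := fun i => M (i + 1)) (p := fun i => p (i + 1))
      (fun i => hp (i + 1)) m
    refine ⟨⟨fun i => Nat.casesOn i (p 0 (x.1 0)) x.1, fun i => ?_⟩, hx⟩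
    cases i with
    | zero => rfl
    | succ i => exact x.2 i

variable [∀ i, TopologicalSpace (M i)]

theorem continuous_apply (k : ℕ) : Continuous fun x : InverseLimit p => x.1 k :=
  (_root_.continuous_apply k).comp continuous_subtype_val

theorem isClosed_setOf_compatible [∀ i, T2Space (M i)] (hp : ∀ i, Continuous (p i)) :
    IsClosed {x : ∀ i, M i | ∀ i, p i (x (i + 1)) = x i} := by
  simp only [ofPred_forall]
  exact isClosed_iInter fun i =>
    isClosed_eq ((hp i).comp (_root_.continuous_apply _)) (_root_.continuous_apply i)

theorem compactSpace [∀ i, T2Space (M i)] [∀ i, CompactSpace (M i)] (hp : ∀ i, Continuous (p i)) :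
    CompactSpace (InverseLimit p) :=
  isCompact_iff_compactSpace.1 (isClosed_setOf_compatible hp).isCompact

theorem preconnectedSpace [∀ i, T2Space (M i)] [∀ i, CompactSpace (M i)]
    [∀ i, PreconnectedSpace (M i)] (hp : ∀ i, Continuous (p i))
    (hs : ∀ i, Function.Surjective (p i)) : PreconnectedSpace (InverseLimit p) := by
  have := compactSpace hp
  rw [preconnectedSpace_iff_clopen]
  intro A hA
  by_contra! h
  obtain ⟨hA₀, hA₁⟩ := h
  let t : ℕ → Set (InverseLimit p × InverseLimit p) :=
    fun k => (A ×ˢ Aᶜ) ∩ {z | z.1.1 k = z.2.1 k}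
  have hcl : ∀ k, IsClosed (t k) := fun k =>
    (hA.isClosed.prod hA.compl.isClosed).inter
      (isClosed_eq ((continuous_apply k).comp continuous_fst)
        ((continuous_apply k).comp continuous_snd))
  -- The images of `A` and `Aᶜ` are closed and cover the connected `M k`, so they meet.
  have hne : ∀ k, (t k).Nonempty := by
    intro k
    let π : InverseLimit p → M k := fun x => x.1 k
    have hπ : Continuous π := continuous_apply k
    have hcover : (univ : Set (M k)) ⊆ π '' A ∪ π '' Aᶜ := by
      rw [← image_union, union_compl_self, image_univ, (surjective_apply hs k).range_eq]
    obtain ⟨_, -, ⟨x, hx, rfl⟩, y, hy, hxy⟩ :=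
      isPreconnected_closed_iff.1 (isPreconnected_univ (α := M k)) _ _
        (hA.isClosed.isCompact.image hπ).isClosed
        (hA.compl.isClosed.isCompact.image hπ).isClosed hcover
        (by simpa using hA₀)
        (by simpa [nonempty_compl] using hA₁)
    exact ⟨(x, y), ⟨hx, hy⟩, hxy.symm⟩
  obtain ⟨⟨x, y⟩, hxy⟩ := IsCompact.nonempty_iInter_of_sequence_nonempty_isCompact_isClosed t
    (fun k z hz => ⟨hz.1, eq_of_apply_eq_of_le k.le_succ hz.2⟩) hne (hcl 0).isCompact hcl
  have hxy' := mem_iInter.1 hxy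
  have : x = y := Subtype.ext (funext fun k => (hxy' k).2)
  exact (hxy' 0).1.2 (this ▸ (hxy' 0).1.1)

end InverseLimit

end Bonding

/-! ### Deck transformations of the solenoid -/

section Deck

variable {M : ℕ → Type*} [∀ i, TopologicalSpace (M i)] {p : ∀ i, M (i + 1) → M i}

/-- The homeomorphism of the inverse limit induced by a compatible family of homeomorphisms. -/
def InverseLimit.congr (d : ∀ k, M k ≃ₜ M k) (hd : ∀ k x, p k (d (k + 1) x) = d k (p k x)) :
    InverseLimit p ≃ₜ InverseLimit p where
  toFun x := ⟨fun k => d k (x.1 k), fun k => by rw [hd, x.2]⟩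
  invFun x := ⟨fun k => (d k).symm (x.1 k), fun k => by
    rw [Homeomorph.eq_symm_apply, ← hd, Homeomorph.apply_symm_apply, x.2]⟩
  left_inv x := by simp
  right_inv x := by simp
  continuous_toFun := Continuous.subtype_mk
    (continuous_pi fun k => (d k).continuous.comp (InverseLimit.continuous_apply k)) _
  continuous_invFun := Continuous.subtype_mk
    (continuous_pi fun k => (d k).symm.continuous.comp (InverseLimit.continuous_apply k)) _

/-- The structure group acts transitively on the fibres of the solenoid. -/
theorem IsSolenoidSequence.exists_deck_apply_eq [∀ i, PreconnectedSpace (M i)]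
    (hp : IsSolenoidSequence p) {x y : InverseLimit p} (hxy : x.1 0 = y.1 0) :
    ∃ σ ∈ deckGroup (InverseLimit.proj₀ p), σ x = y := by
  have hreg := hp.isRegularCoveringMap_bondingToBase
  have hex : ∀ k, ∃ d ∈ deckGroup (bondingToBase p k), d (x.1 k) = y.1 k := fun k =>
    (hreg k).transitive _ _ (by rw [x.bondingToBase_apply, y.bondingToBase_apply, hxy])
  choose d hd hdx using hex
  -- Both sides lift `bondingToBase p (k + 1)` through `bondingToBase p k` and agree at one point.
  have hcomp : ∀ k, p k ∘ d (k + 1) = d k ∘ p k := by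
    intro k
    refine (hreg k).isCoveringMap.eq_of_comp_eq
      ((hp.covering k).continuous.comp (d (k + 1)).continuous)
      ((d k).continuous.comp (hp.covering k).continuous) ?_ (x.1 (k + 1)) ?_
    · ext z
      exact (hd (k + 1) z).trans (hd k (p k z)).symm
    · simp only [Function.comp_apply, hdx, x.2, y.2]
  exact ⟨InverseLimit.congr d fun k z => congrFun (hcomp k) z, fun z => hd 0 (z.1 0),
    Subtype.ext (funext hdx)⟩

/-- A deck transformation of the solenoid covers a deck transformation at every level. -/
theorem IsSolenoidSequence.exists_deck_level [PreconnectedSpace (InverseLimit p)]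
    [Nonempty (InverseLimit p)] (hp : IsSolenoidSequence p)
    {σ : InverseLimit p ≃ₜ InverseLimit p} (hσ : σ ∈ deckGroup (InverseLimit.proj₀ p)) (k : ℕ) :
    ∃ d ∈ deckGroup (bondingToBase p k), ∀ x : InverseLimit p, (σ x).1 k = d (x.1 k) := by
  have hreg := hp.isRegularCoveringMap_bondingToBase k
  have hσ₀ : ∀ x, (σ x).1 0 = x.1 0 := hσ
  obtain ⟨x₀⟩ := ‹Nonempty (InverseLimit p)›
  obtain ⟨d, hd, hdx⟩ := hreg.transitive (x₀.1 k) ((σ x₀).1 k)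
    (by rw [InverseLimit.bondingToBase_apply, InverseLimit.bondingToBase_apply, hσ₀])
  refine ⟨d, hd, fun x => congrFun (hreg.isCoveringMap.eq_of_comp_eq
    (g₁ := fun x : InverseLimit p => (σ x).1 k) (g₂ := fun x : InverseLimit p => d (x.1 k))
    ((InverseLimit.continuous_apply k).comp σ.continuous)
    (d.continuous.comp (InverseLimit.continuous_apply k)) ?_ x₀ hdx.symm) x⟩
  ext x
  simp only [Function.comp_apply]
  rw [InverseLimit.bondingToBase_apply, hσ₀, hd, InverseLimit.bondingToBase_apply]

/-- Deck transformations of the solenoid that agree at one point at level `k` agree at level `k`. -/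
theorem IsSolenoidSequence.deck_apply_eq_of_apply_eq [PreconnectedSpace (InverseLimit p)]
    (hp : IsSolenoidSequence p) {σ τ : InverseLimit p ≃ₜ InverseLimit p}
    (hσ : σ ∈ deckGroup (InverseLimit.proj₀ p)) (hτ : τ ∈ deckGroup (InverseLimit.proj₀ p))
    {k : ℕ} {x₀ : InverseLimit p} (h : (σ x₀).1 k = (τ x₀).1 k) (x : InverseLimit p) :
    (σ x).1 k = (τ x).1 k := by
  have hreg := hp.isRegularCoveringMap_bondingToBase k
  refine congrFun (hreg.isCoveringMap.eq_of_comp_eq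
    (g₁ := fun x : InverseLimit p => (σ x).1 k) (g₂ := fun x : InverseLimit p => (τ x).1 k)
    ((InverseLimit.continuous_apply k).comp σ.continuous)
    ((InverseLimit.continuous_apply k).comp τ.continuous) ?_ x₀ h) x
  ext x
  simp only [Function.comp_apply]
  rw [InverseLimit.bondingToBase_apply, InverseLimit.bondingToBase_apply]
  exact (hσ x).trans (hτ x).symm

/-- The deck transformations of the solenoid that act trivially at level `k`. -/
def levelSubgroup (p : ∀ i, M (i + 1) → M i) (k : ℕ) : Subgroup (structureGroup p) where
  carrier := {σ | ∀ x, (σ.1 x).1 k = x.1 k}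
  one_mem' := fun _ => rfl
  mul_mem' := fun {a b} ha hb x => (ha (b.1 x)).trans (hb x)
  inv_mem' := fun {a} ha x => by
    have h := ha (a.1⁻¹ x)
    rw [show a.1 (a.1⁻¹ x) = x from a.1.apply_symm_apply x] at h
    exact h.symm

/-- Evaluation at `x₀` is continuous, and fibres over `M 0` are discrete at level `k`: moving `x₀`
little there means fixing it there, hence acting trivially there. -/
theorem IsSolenoidSequence.isOpen_levelSubgroup [PreconnectedSpace (InverseLimit p)]
    [Nonempty (InverseLimit p)] (hp : IsSolenoidSequence p) (k : ℕ) :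
    IsOpen (levelSubgroup p k : Set (structureGroup p)) := by
  obtain ⟨x₀⟩ := ‹Nonempty (InverseLimit p)›
  have hreg := hp.isRegularCoveringMap_bondingToBase k
  obtain ⟨O, hO, hxO, hinj⟩ := hreg.isCoveringMap.isLocalHomeomorph.isLocallyInjective (x₀.1 k)
  have hcont : Continuous fun σ : structureGroup p => (σ.1 x₀).1 k :=
    (InverseLimit.continuous_apply k).comp
      ((continuous_eval_const (F := C(InverseLimit p, InverseLimit p)) x₀).comp
        (continuous_induced_dom (f := fun σ : structureGroup p =>
          ((σ : InverseLimit p ≃ₜ InverseLimit p) : C(InverseLimit p, InverseLimit p)))))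
  convert hO.preimage hcont using 1
  ext σ
  refine ⟨fun hσ => ?_, fun hσ => ?_⟩
  · rw [mem_preimage, show (σ.1 x₀).1 k = x₀.1 k from hσ x₀]
    exact hxO
  · have h : (σ.1 x₀).1 k = x₀.1 k := hinj hσ hxO (by
      rw [InverseLimit.bondingToBase_apply, InverseLimit.bondingToBase_apply]
      exact σ.2 x₀)
    exact hp.deck_apply_eq_of_apply_eq σ.2 (one_mem _) h

end Deck

/-! ### Countable decomposition and Baire category -/

/-- A family of continuous maps from a compact second countable space decomposes into countably
many subfamilies whose members are pairwise close. -/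
theorem exists_nat_index_close {ι X B : Type*} [TopologicalSpace X] [TopologicalSpace B]
    [CompactSpace X] [LocallyCompactSpace X] [SecondCountableTopology X]
    [SecondCountableTopology B] {V : Set (B × B)} (hV : IsOpen V) (hdiag : ∀ b, (b, b) ∈ V)
    (f : ι → C(X, B)) : ∃ N : ι → ℕ, ∀ i j, N i = N j → ∀ x, (f i x, f j x) ∈ V := by
  have hloc : ∀ u : C(X, B), ∃ O ∈ 𝓝 u, ∀ v ∈ O, ∀ w ∈ O, ∀ x, (v x, w x) ∈ V := by
    intro u
    have hev : ∀ᶠ z : C(X, B) × C(X, B) in 𝓝 (u, u), ∀ x ∈ (univ : Set X), (z.1 x, z.2 x) ∈ V := by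
      refine isCompact_univ.eventually_forall_of_forall_eventually fun x _ => ?_
      have hc : Continuous fun z : (C(X, B) × C(X, B)) × X => (z.1.1 z.2, z.1.2 z.2) := by
        fun_prop
      exact hc.continuousAt.eventually (hV.mem_nhds (hdiag (u x)))
    rw [nhds_prod_eq] at hev
    obtain ⟨O, hO, h⟩ := eventually_prod_self_iff'.1 hev
    exact ⟨O, hO, fun v hv w hw x => h v hv w hw x (mem_univ x)⟩
  choose O hO hOV using hloc
  obtain ⟨s, hs, hcover⟩ := TopologicalSpace.countable_cover_nhds hO
  have hex : ∀ i, ∃ u : s, f i ∈ O u := by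
    intro i
    obtain ⟨u, hu, hi⟩ := mem_iUnion₂.1 (hcover ▸ mem_univ (f i))
    exact ⟨⟨u, hu⟩, hi⟩
  choose c hc using hex
  have := hs.to_subtype
  obtain ⟨e, he⟩ := exists_injective_nat s
  refine ⟨fun i => e (c i), fun i j hij => hOV (c i) _ (hc i) _ ?_⟩
  rw [he hij]
  exact hc j

/-- The fibres of `N` need not be closed, so Baire is applied to their closures; the resulting open
set meets the fibre itself. -/
theorem exists_mem_interior_closure_fiber {X : Type*} [TopologicalSpace X] [BaireSpace X]
    [Nonempty X] (N : X → ℕ) : ∃ x, x ∈ interior (closure {y | N y = N x}) := by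
  obtain ⟨n, hn⟩ := nonempty_interior_of_iUnion_of_closed
    (f := fun n => closure {y | N y = n}) (fun _ => isClosed_closure)
    (eq_univ_of_forall fun y => mem_iUnion.2 ⟨N y, subset_closure rfl⟩)
  obtain ⟨y, hy⟩ := hn
  obtain ⟨x, hx, rfl⟩ := mem_closure_iff.1 (interior_subset hy) _ isOpen_interior hy
  exact ⟨x, hx⟩

/-! ### Plaques of the solenoid and local inversion -/

section

variable {M : ℕ → Type*} [∀ i, TopologicalSpace (M i)] {p : ∀ i, M (i + 1) → M i}

theorem InverseLimit.exists_level_subset_of_diagonal [∀ i, T2Space (M i)]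
    [CompactSpace (InverseLimit p)] {W : Set (InverseLimit p × InverseLimit p)} (hW : IsOpen W)
    (hdiag : ∀ x, (x, x) ∈ W) : ∃ k, ∀ x y : InverseLimit p, x.1 k = y.1 k → (x, y) ∈ W := by
  by_contra! h
  let t : ℕ → Set (InverseLimit p × InverseLimit p) := fun k => {z | z.1.1 k = z.2.1 k} ∩ Wᶜ
  have hcl : ∀ k, IsClosed (t k) := fun k =>
    (isClosed_eq ((continuous_apply k).comp continuous_fst)
      ((continuous_apply k).comp continuous_snd)).inter hW.isClosed_compl
  obtain ⟨⟨x, y⟩, hxy⟩ := IsCompact.nonempty_iInter_of_sequence_nonempty_isCompact_isClosed t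
    (fun k z hz => ⟨eq_of_apply_eq_of_le k.le_succ hz.1, hz.2⟩)
    (fun k => let ⟨x, y, hxy, hW⟩ := h k; ⟨(x, y), hxy, hW⟩) (hcl 0).isCompact hcl
  have hxy' := mem_iInter.1 hxy
  have : x = y := Subtype.ext (funext fun k => (hxy' k).1)
  exact (hxy' 0).2 (this ▸ hdiag x)

theorem InverseLimit.exists_level_subset_of_mem_nhds [∀ i, T2Space (M i)]
    [CompactSpace (InverseLimit p)] {x : InverseLimit p} {O : Set (InverseLimit p)}
    (hO : O ∈ 𝓝 x) : ∃ k, ∀ y : InverseLimit p, y.1 k = x.1 k → y ∈ O := by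
  obtain ⟨k, hk⟩ := exists_level_subset_of_diagonal
    -- This open set contains the diagonal, and its slice at second coordinate `x` is `interior O`.
    (W := Prod.snd ⁻¹' {x}ᶜ ∪ Prod.fst ⁻¹' interior O)
    ((isOpen_compl_singleton.preimage continuous_snd).union
      (isOpen_interior.preimage continuous_fst)) (fun y => by
        by_cases h : y = x
        · exact .inr (h ▸ mem_interior_iff_mem_nhds.2 hO)
        · exact .inl h)
  exact ⟨k, fun y hy => interior_subset ((hk y x hy).resolve_left fun h => h rfl)⟩

/-- Two points of the inverse limit are in the same plaque if they are at every level. -/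
def InverseLimit.SamePlaque (𝒞 : Set (Set (M 0))) (x y : InverseLimit p) : Prop :=
  ∀ k, _root_.SamePlaque (bondingToBase p k) 𝒞 (x.1 k) (y.1 k)

variable {𝒞 : Set (Set (M 0))}

theorem InverseLimit.SamePlaque.of_preconnected [PreconnectedSpace (InverseLimit p)]
    [∀ i, LocallyConnectedSpace (M i)] (hp : IsSolenoidSequence p) (h𝒞 : IsPlaqueCover 𝒞)
    {f g : InverseLimit p → InverseLimit p} (hf : Continuous f) (hg : Continuous g)
    (hfg : ∀ x, ∃ C ∈ 𝒞, (f x).1 0 ∈ C ∧ (g x).1 0 ∈ C) {x₀ : InverseLimit p}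
    (h₀ : SamePlaque 𝒞 (f x₀) (g x₀)) (x : InverseLimit p) : SamePlaque 𝒞 (f x) (g x) := by
  intro k
  refine h𝒞.samePlaque_of_preconnected (hp.isRegularCoveringMap_bondingToBase k).isCoveringMap
    (f := fun x => (f x).1 k) (g := fun x => (g x).1 k)
    ((continuous_apply k).comp hf) ((continuous_apply k).comp hg) (fun x => ?_) (h₀ k) x
  simpa only [bondingToBase_apply] using hfg x

theorem InverseLimit.SamePlaque.map_deck [PreconnectedSpace (InverseLimit p)]
    (hp : IsSolenoidSequence p) (σ : structureGroup p) {x y : InverseLimit p}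
    (h : SamePlaque 𝒞 x y) : SamePlaque 𝒞 (σ.1 x) (σ.1 y) := by
  intro k
  have : Nonempty (InverseLimit p) := ⟨x⟩
  obtain ⟨d, hd, hσ⟩ := hp.exists_deck_level σ.2 k
  obtain ⟨C, hC, hxy⟩ := h k
  rw [hσ, hσ]
  exact ⟨C, hC, hxy.map_deck hd⟩

theorem InverseLimit.SamePlaque.refl (h𝒞 : IsPlaqueCover 𝒞) (x : InverseLimit p) :
    SamePlaque 𝒞 x x := by
  intro k
  obtain ⟨C, hC, hx⟩ := h𝒞.exists_mem (x.1 0)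
  refine ⟨C, hC, {x.1 k}, isPreconnected_singleton, ?_, rfl, rfl⟩
  rw [singleton_subset_iff, mem_preimage, bondingToBase_apply]
  exact hx

theorem InverseLimit.eventually_apply_eq (hp : IsSolenoidSequence p) (x : InverseLimit p) (k : ℕ) :
    ∀ᶠ y in 𝓝 x, y.1 0 = x.1 0 → y.1 k = x.1 k := by
  obtain ⟨O, hO, hxO, hinj⟩ := (hp.isRegularCoveringMap_bondingToBase
    k).isCoveringMap.isLocalHomeomorph.isLocallyInjective (x.1 k)
  filter_upwards [(continuous_apply k).continuousAt.eventually (hO.mem_nhds hxO)] with y hy h₀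
  exact hinj hy hxO (by rw [bondingToBase_apply, bondingToBase_apply, h₀])

/-- In a bihomogeneous solenoid some homeomorphism acts near some point of a fibre, up to plaques,
as inversion of the structure group. -/
theorem IsSolenoidSequence.exists_homeomorph_inverting [∀ i, T2Space (M i)]
    [∀ i, CompactSpace (M i)] [∀ i, PreconnectedSpace (M i)] [∀ i, LocallyConnectedSpace (M i)]
    [∀ i, SecondCountableTopology (M i)] [PreconnectedSpace (InverseLimit p)]
    [Nonempty (InverseLimit p)]
    (hp : IsSolenoidSequence p) (h𝒞 : IsPlaqueCover 𝒞) (hb : IsBihomogeneous (InverseLimit p)) :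
    ∃ (x₀ y₀ : InverseLimit p) (h : InverseLimit p ≃ₜ InverseLimit p) (k : ℕ), h y₀ = x₀ ∧
      ∀ τ ∈ levelSubgroup p k, InverseLimit.SamePlaque 𝒞 (h (τ.1 y₀)) (τ.1⁻¹ x₀) := by
  have : CompactSpace (InverseLimit p) :=
    InverseLimit.compactSpace fun i => (hp.covering i).continuous
  have : SecondCountableTopology (InverseLimit p) :=
    Topology.IsInducing.subtypeVal.secondCountableTopology
  obtain ⟨x₀⟩ := ‹Nonempty (InverseLimit p)›
  let F := {y : InverseLimit p // y.1 0 = x₀.1 0}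
  have hFcl : IsClosed {y : InverseLimit p | y.1 0 = x₀.1 0} :=
    isClosed_eq (InverseLimit.continuous_apply 0) continuous_const
  have : CompactSpace F := isCompact_iff_compactSpace.1 hFcl.isCompact
  have : Nonempty F := ⟨⟨x₀, rfl⟩⟩
  choose h hx hy using fun y : F => hb x₀ y.1
  choose s hs hsx using fun y : F => hp.exists_deck_apply_eq (x := x₀) (y := y.1) y.2.symm
  let V : Set (M 0 × M 0) := ⋃ C ∈ 𝒞, C ×ˢ C
  obtain ⟨N, hN⟩ := exists_nat_index_close (V := V)
    (isOpen_biUnion fun C hC => (h𝒞.isOpen C hC).prod (h𝒞.isOpen C hC))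
    (fun b => let ⟨C, hC, hb⟩ := h𝒞.exists_mem b; mem_biUnion hC ⟨hb, hb⟩)
    (fun y : F => (⟨fun x => (h y x).1 0,
      (InverseLimit.continuous_apply 0).comp (h y).continuous⟩ : C(InverseLimit p, M 0)))
  obtain ⟨y₀, hy₀⟩ := exists_mem_interior_closure_fiber N
  -- Composing `h y` with a deck transformation keeps its projection to `M 0` and moves its value at
  -- `x₀` from `y` to `y₀`.
  have hS : ∀ y, N y = N y₀ →
      InverseLimit.SamePlaque 𝒞 (h y₀ y.1) ((s y₀ * (s y)⁻¹) x₀) := by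
    intro y hNy
    have hdeck : s y₀ * (s y)⁻¹ ∈ deckGroup (InverseLimit.proj₀ p) :=
      mul_mem (hs y₀) (inv_mem (hs y))
    have := InverseLimit.SamePlaque.of_preconnected hp h𝒞 (f := h y₀)
      (g := fun x => (s y₀ * (s y)⁻¹) (h y x)) (h y₀).continuous
      ((s y₀ * (s y)⁻¹).continuous.comp (h y).continuous) (fun x => ?_) (x₀ := x₀) ?_ y.1
    · rwa [hy y] at this
    · obtain ⟨C, hC, h₁, h₂⟩ := mem_iUnion₂.1 (hN y₀ y hNy.symm x)
      refine ⟨C, hC, h₁, ?_⟩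
      rw [show ((s y₀ * (s y)⁻¹) (h y x)).1 0 = (h y x).1 0 from hdeck (h y x)]
      exact h₂
    · rw [hx, hx, show (s y₀ * (s y)⁻¹) y.1 = s y₀ ((s y)⁻¹ y.1) from rfl,
        show (s y)⁻¹ y.1 = x₀ from (s y).symm_apply_eq.2 (hsx y).symm, hsx]
      exact .refl h𝒞 _
  obtain ⟨O, hO, hOsub⟩ := mem_nhds_induced _ _ _ |>.1 (mem_interior_iff_mem_nhds.1 hy₀)
  obtain ⟨C₀, hC₀, hxC₀⟩ := h𝒞.exists_mem (x₀.1 0)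
  have hO' : O ∩ {y | (h y₀ y).1 0 ∈ C₀} ∈ 𝓝 y₀.1 := by
    refine inter_mem hO (((InverseLimit.continuous_apply 0).comp
      (h y₀).continuous).continuousAt.preimage_mem_nhds ((h𝒞.isOpen C₀ hC₀).mem_nhds ?_))
    simpa only [Function.comp_apply, hy] using hxC₀
  obtain ⟨k, hk⟩ := InverseLimit.exists_level_subset_of_mem_nhds hO'
  refine ⟨x₀, y₀.1, h y₀, k, hy y₀, fun τ hτ l => ?_⟩
  obtain ⟨hyO, hyC⟩ := hk _ (hτ y₀.1)
  let y : F := ⟨τ.1 y₀.1, (τ.2 y₀.1).trans y₀.2⟩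
  have hycl : y ∈ closure {z | N z = N y₀} := hOsub hyO
  have hτinv : τ.1⁻¹ ∈ deckGroup (InverseLimit.proj₀ p) := inv_mem τ.2
  have hcov := (hp.isRegularCoveringMap_bondingToBase l).isCoveringMap
  have hev := h𝒞.eventually_samePlaque_iff hcov hC₀ (a := (h y₀ y.1).1 l) (b := (τ.1⁻¹ x₀).1 l)
    (by rwa [InverseLimit.bondingToBase_apply])
    (by rw [InverseLimit.bondingToBase_apply, show (τ.1⁻¹ x₀).1 0 = x₀.1 0 from hτinv x₀]
        exact hxC₀)
  have hcont : Continuous fun z : F => ((h y₀ z.1).1 l, (τ.1⁻¹ x₀).1 l) :=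
    ((InverseLimit.continuous_apply l).comp
      ((h y₀).continuous.comp continuous_subtype_val)).prodMk continuous_const
  have hev₂ : ∀ᶠ z : F in 𝓝 y, z.1.1 0 = y.1.1 0 → z.1.1 l = y.1.1 l :=
    continuous_subtype_val.continuousAt.eventually (InverseLimit.eventually_apply_eq hp y.1 l)
  -- `y` is only a limit of the class. At the fixed level `l` a nearby `z` in the class can replace
  -- it: it agrees with `y` there, and the plaque relation is locally constant.
  obtain ⟨z, hzN, hz₁, hz₂⟩ := ((mem_closure_iff_frequently.1 hycl).and_eventually
    ((hcont.continuousAt.eventually hev).and hev₂)).exists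
  refine hz₁.1 ?_
  have hρ : τ.1 * (s y₀ * (s z)⁻¹) ∈ deckGroup (InverseLimit.proj₀ p) :=
    mul_mem τ.2 (mul_mem (hs y₀) (inv_mem (hs z)))
  have hρz : (τ.1 * (s y₀ * (s z)⁻¹)) z.1 = y.1 := by
    rw [show (τ.1 * (s y₀ * (s z)⁻¹)) z.1 = τ.1 (s y₀ ((s z)⁻¹ z.1)) from rfl,
      show (s z)⁻¹ z.1 = x₀ from (s z).symm_apply_eq.2 (hsx z).symm, hsx]
  have hρx : ((τ.1 * (s y₀ * (s z)⁻¹)) x₀).1 l = x₀.1 l :=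
    hp.deck_apply_eq_of_apply_eq hρ (one_mem _) (x₀ := z.1)
      (by rw [hρz]; exact (hz₂ (z.2.trans y.2.symm)).symm) x₀
  have : Nonempty (InverseLimit p) := ⟨x₀⟩
  obtain ⟨d, -, hd⟩ := hp.exists_deck_level hτinv l
  have heq : ((s y₀ * (s z)⁻¹) x₀).1 l = (τ.1⁻¹ x₀).1 l := by
    rw [hd, ← hρx, ← hd]
    exact congrArg (fun w : InverseLimit p => w.1 l) (τ.1.symm_apply_apply _).symm
  rw [← heq]
  exact hS z hzN l

/-- A homeomorphism of the solenoid that acts near a point, up to plaques, as inversion of the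
structure group forces the structure group to be abelian near the identity. -/
theorem IsSolenoidSequence.exists_levelSubgroup_commute [∀ i, T2Space (M i)]
    [∀ i, LocallyConnectedSpace (M i)] [PreconnectedSpace (InverseLimit p)]
    [CompactSpace (InverseLimit p)] (hp : IsSolenoidSequence p)
    (h𝒞 : IsPlaqueCover 𝒞) {x₀ y₀ : InverseLimit p} {h : InverseLimit p ≃ₜ InverseLimit p} {k : ℕ}
    (hy₀ : h y₀ = x₀)
    (hinv : ∀ τ ∈ levelSubgroup p k, InverseLimit.SamePlaque 𝒞 (h (τ.1 y₀)) (τ.1⁻¹ x₀)) :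
    ∃ j, ∀ a ∈ levelSubgroup p j, ∀ b ∈ levelSubgroup p j, a * b = b * a := by
  obtain ⟨C₀, hC₀, hxC₀⟩ := h𝒞.exists_mem (x₀.1 0)
  have hh : Continuous fun x => (h x).1 0 := (InverseLimit.continuous_apply 0).comp h.continuous
  obtain ⟨k₁, hk₁⟩ := InverseLimit.exists_level_subset_of_mem_nhds (x := y₀)
    (hh.continuousAt.preimage_mem_nhds ((h𝒞.isOpen C₀ hC₀).mem_nhds (by rwa [hy₀])))
  obtain ⟨k₂, hk₂⟩ := InverseLimit.exists_level_subset_of_diagonal (p := p)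
    (W := ⋃ C ∈ 𝒞, {z | (h z.1).1 0 ∈ C ∧ (h z.2).1 0 ∈ C})
    (isOpen_biUnion fun C hC => ((h𝒞.isOpen C hC).preimage (hh.comp continuous_fst)).inter
      ((h𝒞.isOpen C hC).preimage (hh.comp continuous_snd)))
    (fun x => let ⟨C, hC, hx⟩ := h𝒞.exists_mem ((h x).1 0); mem_biUnion hC ⟨hx, hx⟩)
  -- `k` gives the inversion, `k₁` keeps `h (σ y₀)` over `C₀`, and `k₂` keeps `h (σ x)` and `h x`
  -- over a common member of `𝒞` for every `x`.
  let j := max k (max k₁ k₂)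
  have hle : ∀ i ≤ j, levelSubgroup p j ≤ levelSubgroup p i := fun i hi σ hσ x =>
    InverseLimit.eq_of_apply_eq_of_le hi (hσ x)
  have hjk : levelSubgroup p j ≤ levelSubgroup p k := hle k (by simp [j])
  have hjk₁ : levelSubgroup p j ≤ levelSubgroup p k₁ := hle k₁ (by simp [j])
  have hjk₂ : levelSubgroup p j ≤ levelSubgroup p k₂ := hle k₂ (by simp [j])
  have hmem : ∀ σ ∈ levelSubgroup p j, (h (σ.1 y₀)).1 0 ∈ C₀ := fun σ hσ => hk₁ _ (hjk₁ hσ y₀)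
  have hdeck : ∀ (σ : structureGroup p) x, (σ.1 x).1 0 = x.1 0 := fun σ => σ.2
  refine ⟨j, fun a ha b hb => ?_⟩
  suffices hinv' : a⁻¹ * b⁻¹ = b⁻¹ * a⁻¹ by
    rw [← mul_inv_rev, ← mul_inv_rev, inv_inj] at hinv'
    exact hinv'.symm
  have hpt : (a⁻¹ * b⁻¹).1 x₀ = (b⁻¹ * a⁻¹).1 x₀ := by
    have h₁ : InverseLimit.SamePlaque 𝒞 (h (a.1 (b.1 y₀))) ((a⁻¹).1 (h (b.1 y₀))) := by
      refine InverseLimit.SamePlaque.of_preconnected hp h𝒞 (f := fun x => h (a.1 x))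
        (g := fun x => (a⁻¹).1 (h x)) (h.continuous.comp a.1.continuous)
        ((a⁻¹).1.continuous.comp h.continuous) (fun x => ?_) (x₀ := y₀) ?_ (b.1 y₀)
      · obtain ⟨C, hC, hx⟩ := mem_iUnion₂.1 (hk₂ (a.1 x) x (hjk₂ ha x))
        exact ⟨C, hC, hx.1, by rw [hdeck]; exact hx.2⟩
      · have := hinv a (hjk ha)
        rw [← hy₀] at this
        exact this
    have h₂ : InverseLimit.SamePlaque 𝒞 ((a⁻¹).1 (h (b.1 y₀))) ((a⁻¹ * b⁻¹).1 x₀) :=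
      (hinv b (hjk hb)).map_deck hp a⁻¹
    have h₃ : InverseLimit.SamePlaque 𝒞 (h (a.1 (b.1 y₀))) ((b⁻¹ * a⁻¹).1 x₀) := by
      have := hinv (a * b) (hjk (mul_mem ha hb))
      rw [show (a * b).1⁻¹ = (b⁻¹ * a⁻¹).1 from congrArg Subtype.val (mul_inv_rev a b)] at this
      exact this
    have hm₁ := hmem (a * b) (mul_mem ha hb)
    have hm₂ : ((a⁻¹).1 (h (b.1 y₀))).1 0 ∈ C₀ := by rw [hdeck]; exact hmem b hb
    have hm : ∀ σ : structureGroup p, (σ.1 x₀).1 0 ∈ C₀ := fun σ => by rwa [hdeck]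
    refine Subtype.ext (funext fun l => ?_)
    have hcov := (hp.isRegularCoveringMap_bondingToBase l).isCoveringMap
    have key : ∀ {x y : InverseLimit p}, x.1 0 ∈ C₀ → y.1 0 ∈ C₀ →
        InverseLimit.SamePlaque 𝒞 x y → SameSheet (bondingToBase p l) C₀ (x.1 l) (y.1 l) :=
      fun {x y} hx hy hxy => h𝒞.sameSheet_of_samePlaque hcov hC₀
        (by rwa [x.bondingToBase_apply]) (by rwa [y.bondingToBase_apply]) (hxy l)
    -- Being in the same plaque is not transitive in general; over the single member `C₀` it is,
    -- which allows chaining the three relations.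
    refine h𝒞.eq_of_sameSheet hcov hC₀ ((key hm₂ (hm _) h₂).symm.trans
      ((key hm₁ hm₂ h₁).symm.trans (key hm₁ (hm _) h₃))) ?_
    rw [InverseLimit.bondingToBase_apply, InverseLimit.bondingToBase_apply, hdeck, hdeck]
  exact Subtype.ext (Homeomorph.ext fun x => Subtype.ext (funext fun l =>
    hp.deck_apply_eq_of_apply_eq (a⁻¹ * b⁻¹).2 (b⁻¹ * a⁻¹).2
      (congrArg (fun z : InverseLimit p => z.1 l) hpt) x))

end

theorem theorem3p5 (n : ℕ) (M : ℕ → Type*)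
    [∀ i, TopologicalSpace (M i)] [∀ i, ChartedSpace (EuclideanSpace ℝ (Fin n)) (M i)]
    [∀ i, T2Space (M i)] [∀ i, CompactSpace (M i)] [∀ i, ConnectedSpace (M i)]
    (p : ∀ i, M (i + 1) → M i) (hp : IsSolenoidSequence p)
    (hb : IsBihomogeneous (InverseLimit p)) :
    ∃ A : Subgroup (structureGroup p),
      IsOpen (A : Set (structureGroup p)) ∧ ∀ a ∈ A, ∀ b ∈ A, a * b = b * a := by
  have : ∀ i, LocallyConnectedSpace (M i) := fun i =>
    ChartedSpace.locallyConnectedSpace (EuclideanSpace ℝ (Fin n)) (M i)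
  have : ∀ i, SecondCountableTopology (M i) := fun i =>
    ChartedSpace.secondCountable_of_sigmaCompact (EuclideanSpace ℝ (Fin n)) (M i)
  have hsurj : ∀ i, Function.Surjective (p i) := fun i => (hp.covering i).surjective_of_compact
  have hcont : ∀ i, Continuous (p i) := fun i => (hp.covering i).continuous
  have := InverseLimit.compactSpace hcont
  have := InverseLimit.preconnectedSpace hcont hsurj
  have : Nonempty (InverseLimit p) :=
    let ⟨x, _⟩ := InverseLimit.surjective_apply hsurj 0 (Classical.arbitrary (M 0))
    ⟨x⟩
  obtain ⟨𝒞, h𝒞⟩ := exists_isPlaqueCover n (M 0)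
  obtain ⟨x₀, y₀, h, k, hy₀, hinv⟩ := hp.exists_homeomorph_inverting h𝒞 hb
  obtain ⟨j, hj⟩ := hp.exists_levelSubgroup_commute h𝒞 hy₀ hinv
  exact ⟨levelSubgroup p j, hp.isOpen_levelSubgroup j, hj⟩
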